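/- Let $e\ge 3$ be an odd integer. Let $\Phi\in(\mathbb Z/4\mathbb Z)[x]$ be a monic polynomial of degree $e$ that divides $x^{2^e-1}-1$ and whose reduction $\varphi$ modulo $2$ is a primitive polynomial over $\mathrm{GF}(2)$ (irreducible, with a root of multiplicative order $2^e-1$). Let $\mathcal R=(\mathbb Z/4\mathbb Z)[x]/(\Phi)$ be the corresponding Galois ring, $\xi$ the image of $x$ in $\mathcal R$, $\zeta$ the image of $x$ in $K=\mathrm{GF}(2)[x]/(\varphi)=\mathrm{GF}(2^e)$, and $\mathrm{Tr}$ the trace from $K$ to $\mathrm{GF}(2)$. Put $$\mathcal T=\{\xi^j: 0\le j\le 2^e-2\},\quad \mathcal T_0=\{\xi^j: 0\le j\le 2^e-2,\ \mathrm{Tr}(\zeta^j)=0\},\quad \mathcal P=2\mathcal R,\quad \mathcal P_0=2\mathcal T_0\cup\{0\},\quad H=1+\mathcal P_0,$$ $$S_0=\{0\},\quad S_1=(\mathcal T\setminus\{1\})H,\quad S_2=(\mathcal T\setminus\{1\})(-H),\quad S_3=H,\quad S_4=-H,\quad S_5=\mathcal P_0\setminus\{0\},\quad S_6=\mathcal P\setminus\mathcal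 P_0 .$$ For $0\le j\le 6$ let $A_j$ be the adjacency matrix, with rows and columns indexed by $\mathcal R$, of the relation $R_j=\{(\alpha,\beta)\in\mathcal R\times\mathcal R:\alpha-\beta\in S_j\}$. Let $w_0=1$, let $w_1,\dots,w_6$ be complex numbers of absolute value $1$, and assume that $W=\sum_{j=0}^6 w_jA_j$ is hermitian. Then $W$ is a complex Hadamard matrix (all entries have absolute value $1$ and $W\overline W^{\top}=4^e I$) if and only if $$W=A_0+\epsilon_1 i(A_1-A_2)+\epsilon_2 i(A_3-A_4)+A_5+A_6\quad\text{or}\quad W=A_0+\epsilon_1 i(A_1-A_2)+\epsilon_2(A_3+A_4)+A_5-A_6$$ for some $\epsilon_1,\epsilon_2\in\{1,-1\}$. In particular, if $W$ is a complex Hadamard matrix, then it is of Butson type and all its entries are $4$-th roots of unity. -/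

import Mathlib

open Polynomial Matrix
open scoped Pointwise

/-- A complex Hadamard matrix: all entries have absolute value `1`, and `W W* = n I`,
where `n` is the order of `W`. -/
def IsComplexHadamard {ι : Type*} [Fintype ι] [DecidableEq ι] (W : Matrix ι ι ℂ) : Prop :=
  (∀ x y, ‖W x y‖ = 1) ∧ W * Wᴴ = (Fintype.card ι : ℂ) • (1 : Matrix ι ι ℂ)

/-- A Butson-type complex Hadamard matrix all of whose entries are `q`-th roots of unity. -/
def IsButsonType {ι : Type*} [Fintype ι] [DecidableEq ι] (q : ℕ) (W : Matrix ι ι ℂ) : Prop :=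
  IsComplexHadamard W ∧ ∀ x y, W x y ^ q = 1

/-- Primitive polynomials over `GF(2)`: irreducible (hence monic) polynomials of degree `e`
whose root in `GF(2)[x]/(φ)` has multiplicative order `2 ^ e - 1`. -/
def IsPrimitiveOverGF2 (φ : (ZMod 2)[X]) : Prop :=
  Irreducible φ ∧ orderOf (AdjoinRoot.root φ) = 2 ^ φ.natDegree - 1

/-- Reduction modulo `2` of polynomials over `ℤ/4ℤ`. -/
noncomputable def reduceMod2 (p : (ZMod 4)[X]) : (ZMod 2)[X] :=
  p.map (ZMod.castHom (show 2 ∣ 4 by norm_num) (ZMod 2))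

/-- A polynomial defining the Galois ring of characteristic `4` and order `4 ^ e`: a monic
polynomial of degree `e` over `ℤ/4ℤ` dividing `x ^ (2 ^ e - 1) - 1`, whose reduction modulo `2`
is a primitive polynomial. -/
structure GaloisPolynomial (e : ℕ) where
  poly : (ZMod 4)[X]
  monic : poly.Monic
  natDegree_eq : poly.natDegree = e
  dvd : poly ∣ X ^ (2 ^ e - 1) - 1
  primitive : IsPrimitiveOverGF2 (reduceMod2 poly)

namespace GaloisPolynomial

variable {e : ℕ} (Φ : GaloisPolynomial e)

/-- The Galois ring `ℤ/4ℤ[x]/(Φ)`. -/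
abbrev Ring : Type := AdjoinRoot Φ.poly

theorem finite_ring : Finite Φ.Ring :=
  haveI : Module.Finite (ZMod 4) Φ.Ring := Φ.monic.finite_adjoinRoot
  Module.finite_of_finite (ZMod 4)

noncomputable instance : Fintype Φ.Ring :=
  haveI := Φ.finite_ring
  Fintype.ofFinite _

noncomputable instance : DecidableEq Φ.Ring := Classical.decEq _

/-- The residue field `GF(2)[x]/(φ)`, where `φ` is the reduction of `Φ` modulo `2`. -/
abbrev ResField : Type := AdjoinRoot (reduceMod2 Φ.poly)

/-- The image `ξ` of `x` in the Galois ring. -/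
noncomputable def xi : Φ.Ring := AdjoinRoot.root Φ.poly

/-- The image `ζ` of `x` in the residue field. -/
noncomputable def zeta : Φ.ResField := AdjoinRoot.root (reduceMod2 Φ.poly)

/-- The cyclic group `𝒯 = {ξ ^ j}`. -/
def teich : Set Φ.Ring := {x | ∃ j < 2 ^ e - 1, x = Φ.xi ^ j}

/-- `𝒯₀ = {ξ ^ j : 0 ≤ j ≤ 2 ^ e - 2, Tr (ζ ^ j) = 0}`, with the trace from `GF(2 ^ e)`
to `GF(2)`. -/
def teich0 : Set Φ.Ring :=
  {x | ∃ j < 2 ^ e - 1, Algebra.trace (ZMod 2) Φ.ResField (Φ.zeta ^ j) = 0 ∧ x = Φ.xi ^ j}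

/-- The maximal ideal `𝒫 = 2ℛ`. -/
def maxIdeal : Set Φ.Ring := {x | ∃ r : Φ.Ring, x = 2 * r}

/-- `𝒫₀ = 2𝒯₀ ∪ {0}`. -/
def P0 : Set Φ.Ring := {x | ∃ t ∈ Φ.teich0, x = 2 * t} ∪ {0}

/-- `H = 1 + 𝒫₀`. -/
def H : Set Φ.Ring := {x | ∃ p ∈ Φ.P0, x = 1 + p}

/-- The sets `S₀, …, S₆`; products and negatives of sets are taken elementwise. -/
def S : Fin 7 → Set Φ.Ring :=
  ![{0}, (Φ.teich \ {1}) * Φ.H, (Φ.teich \ {1}) * (-Φ.H), Φ.H, -Φ.H,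
    Φ.P0 \ {0}, Φ.maxIdeal \ Φ.P0]

/-- The relation `R_j = {(α, β) : α - β ∈ S_j}` of the scheme. -/
def R (j : Fin 7) (α β : Φ.Ring) : Prop := α - β ∈ Φ.S j

open scoped Classical in
/-- The adjacency matrix of the relation `R_j`. -/
noncomputable def A (j : Fin 7) : Matrix Φ.Ring Φ.Ring ℂ :=
  Matrix.of fun α β => if Φ.R j α β then 1 else 0

end GaloisPolynomial

/-!
The proof is a computation of autocorrelations. Put `q = 2 ^ e` and let `K` be the residue field,
with the character `ψ s = (-1) ^ Tr s`. An entry of `W` at `(α, β)` is `f (α - β)`, where `f` takes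
the value `w j` on `S j`, so a Hermitian `W` with unimodular entries is Hadamard exactly when the
autocorrelation `∑ₓ f(x) f(α - x)` vanishes at all `α ≠ 0`.

Every element of the Galois ring is uniquely `T u + 2 * T s` with `u, s ∈ K`, where `T` is the
Teichmüller section of the reduction `ℛ → K`, and `T (u + v) = T u + T v + 2 * T (√(u v))`. In these
coordinates (`GaloisPolynomial.E_sub`) the first coordinate is additive, and the second one is
additive up to a correction depending on the first. The scheme is adapted to them
(`GaloisPolynomial.E_mem_S`): on the fibre over `u ≠ 0` the function `f` is
`a u + b u * ψ (s / u)`, where `a u` and `b u` take one value at `u = 1` and another one at all other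
`u ≠ 0`; on the fibre over `0` it is an affine function of `ψ s`, plus a point mass at `s = 0`. Since
`Tr 1 = 1`, negation exchanges `H` and `-H`.

The characters `s ↦ ψ (s / u)` are orthogonal for distinct `u`. For `α` over `z ≠ 0`, the fibres over
`u` and `z + u` that are correlated are distinct, so only the constant terms `a u * a (z + u)` and
the contribution of the fibre over `0` survive (`sum_fibreFun_mul_of_ne_zero`). For `α` over `0` each
fibre is correlated with itself (`sum_fibreFun_mul_zero`).

For a Hermitian `W` the weights are `w 1 = a + b i`, `w 2 = a - b i`, `w 3 = a₃ + b₃ i`,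
`w 4 = a₃ - b₃ i` and `w 5, w 6 = ± 1`. If `w 5 = -1`, the equations over `z ≠ 0` give `b = 0`, hence
`a ^ 2 = 1`, and then a term of size `q (q - 2)` cannot be cancelled. Hence `w 5 = 1`. If `w 6 = 1`,
the equation at `α = 2` gives `(q - 2) a ^ 2 + 2 a₃ ^ 2 = 0`; if `w 6 = -1`, the equations over
`z = 1` give `b₃ = 0` and `a = 0` (`weights_eq_of_autocorr_eqs`). These are the two families of the
theorem, and conversely all autocorrelations vanish for them
(`GaloisPolynomial.isComplexHadamard_of_weights`).
-/

namespace GaloisPolynomial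

variable {e : ℕ} (Φ : GaloisPolynomial e)

/-! ### The residue field -/

instance : Fact (Irreducible (reduceMod2 Φ.poly)) := ⟨Φ.primitive.1⟩

theorem reduce_monic : (reduceMod2 Φ.poly).Monic := Φ.monic.map _

theorem reduce_natDegree : (reduceMod2 Φ.poly).natDegree = e := by
  rw [reduceMod2, Φ.monic.natDegree_map, Φ.natDegree_eq]

theorem degree_ne_zero {e : ℕ} (Φ : GaloisPolynomial e) : e ≠ 0 := by
  have h := Φ.primitive.1.natDegree_pos
  rw [Φ.reduce_natDegree] at h
  omega

instance : Module.Finite (ZMod 2) Φ.ResField := Φ.reduce_monic.finite_adjoinRoot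

noncomputable instance : Fintype Φ.ResField :=
  haveI : Finite Φ.ResField := Module.finite_of_finite (ZMod 2)
  Fintype.ofFinite _

noncomputable instance : DecidableEq Φ.ResField := Classical.decEq _

theorem finrank_resField : Module.finrank (ZMod 2) Φ.ResField = e := by
  rw [(AdjoinRoot.powerBasis' Φ.reduce_monic).finrank, AdjoinRoot.powerBasis'_dim,
    Φ.reduce_natDegree]

theorem card_resField : Fintype.card Φ.ResField = 2 ^ e := by
  rw [Module.card_eq_pow_finrank (K := ZMod 2), ZMod.card, Φ.finrank_resField]

instance : CharP Φ.ResField 2 :=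
  charP_of_injective_algebraMap (algebraMap (ZMod 2) Φ.ResField).injective 2

theorem orderOf_zeta : orderOf Φ.zeta = 2 ^ e - 1 := by
  have h := Φ.primitive.2
  rwa [Φ.reduce_natDegree] at h

theorem zeta_ne_zero : Φ.zeta ≠ 0 := by
  intro h
  have h1 := Φ.orderOf_zeta
  have h2 := Φ.degree_ne_zero
  have h3 : 2 ^ 1 ≤ 2 ^ e := Nat.pow_le_pow_right (by norm_num) (by omega)
  have h4 := pow_orderOf_eq_one Φ.zeta
  rw [h1, h, zero_pow (by omega)] at h4
  exact zero_ne_one h4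

/-- Every nonzero element of the residue field is a power of the primitive element `ζ`. -/
theorem exists_zeta_pow {u : Φ.ResField} (hu : u ≠ 0) : ∃ j < 2 ^ e - 1, Φ.zeta ^ j = u := by
  have hinj : Set.InjOn (fun j => Φ.zeta ^ j) (Finset.range (2 ^ e - 1)) := by
    intro i hi j hj hij
    rw [← Φ.orderOf_zeta] at hi hj
    exact pow_injOn_Iio_orderOf (by simpa using hi) (by simpa using hj) hij
  have himg : (Finset.range (2 ^ e - 1)).image (fun j => Φ.zeta ^ j) = Finset.univ.erase 0 := by
    apply Finset.eq_of_subset_of_card_le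
    · intro x hx
      obtain ⟨j, -, rfl⟩ := Finset.mem_image.1 hx
      exact Finset.mem_erase.2 ⟨pow_ne_zero _ Φ.zeta_ne_zero, Finset.mem_univ _⟩
    · rw [Finset.card_image_of_injOn hinj, Finset.card_erase_of_mem (Finset.mem_univ _),
        Finset.card_range, Finset.card_univ, Φ.card_resField]
  have : u ∈ (Finset.range (2 ^ e - 1)).image (fun j => Φ.zeta ^ j) := by
    rw [himg]; exact Finset.mem_erase.2 ⟨hu, Finset.mem_univ _⟩
  obtain ⟨j, hj, h⟩ := Finset.mem_image.1 this
  exact ⟨j, Finset.mem_range.1 hj, h⟩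

/-- Square roots in the residue field, given by the inverse of the Frobenius automorphism. -/
noncomputable def sqrt (u : Φ.ResField) : Φ.ResField := u ^ 2 ^ (e - 1)

theorem sqrt_sq (u : Φ.ResField) : Φ.sqrt u ^ 2 = u := by
  rw [sqrt, ← pow_mul, ← pow_succ, Nat.sub_add_cancel (Nat.pos_of_ne_zero Φ.degree_ne_zero),
    ← Φ.card_resField, FiniteField.pow_card]

theorem sqrt_sq_eq (u : Φ.ResField) : Φ.sqrt (u ^ 2) = u := by
  rw [← Φ.sqrt_sq u, ← pow_mul]
  have h : Φ.sqrt (Φ.sqrt u ^ (2 * 2)) = Φ.sqrt (Φ.sqrt u) ^ (2 * 2) := by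
    simp only [sqrt, ← pow_mul]; congr 1; ring
  rw [h, pow_mul, Φ.sqrt_sq]

/-- The additive character `x ↦ (-1) ^ Tr x` of the residue field. -/
noncomputable def psi : AddChar Φ.ResField ℂ where
  toFun x := if Algebra.trace (ZMod 2) Φ.ResField x = 0 then 1 else -1
  map_zero_eq_one' := by simp
  map_add_eq_mul' x y := by
    rw [map_add]
    generalize Algebra.trace (ZMod 2) Φ.ResField x = a
    generalize Algebra.trace (ZMod 2) Φ.ResField y = b
    have h : ∀ a b : ZMod 2, a + b = 0 ↔ (a = 0 ↔ b = 0) := by decide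
    by_cases ha : a = 0 <;> by_cases hb : b = 0 <;> simp [h, ha, hb]

theorem psi_apply (x : Φ.ResField) :
    Φ.psi x = if Algebra.trace (ZMod 2) Φ.ResField x = 0 then 1 else -1 := rfl

theorem trace_one_of_odd (he : Odd e) : Algebra.trace (ZMod 2) Φ.ResField 1 = 1 := by
  have h := Algebra.trace_algebraMap (S := Φ.ResField) (1 : ZMod 2)
  rw [map_one, Φ.finrank_resField] at h
  rw [h, nsmul_one]
  exact (ZMod.natCast_eq_one_iff_odd).2 he

theorem psi_one (he : Odd e) : Φ.psi 1 = -1 := by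
  simp [psi_apply, Φ.trace_one_of_odd he]

/-! ### Reduction modulo two -/

/-- Reduction modulo `2`, from the Galois ring to its residue field. -/
noncomputable def red : Φ.Ring →+* Φ.ResField :=
  AdjoinRoot.lift ((AdjoinRoot.of (reduceMod2 Φ.poly)).comp
    (ZMod.castHom (show 2 ∣ 4 by norm_num) (ZMod 2))) Φ.zeta (by
      rw [← eval₂_map]
      exact AdjoinRoot.eval₂_root _)

theorem red_mk (p : (ZMod 4)[X]) :
    Φ.red (AdjoinRoot.mk Φ.poly p) = AdjoinRoot.mk (reduceMod2 Φ.poly) (reduceMod2 p) := by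
  rw [red, AdjoinRoot.lift_mk, ← eval₂_map, ← AdjoinRoot.algebraMap_eq]
  exact AdjoinRoot.aeval_eq _

theorem red_xi : Φ.red Φ.xi = Φ.zeta := by
  rw [red, xi, AdjoinRoot.lift_root]

theorem reduceMod2_surjective : Function.Surjective reduceMod2 :=
  Polynomial.map_surjective _ (ZMod.castHom_surjective _)

theorem reduceMod2_mul (p q : (ZMod 4)[X]) : reduceMod2 (p * q) = reduceMod2 p * reduceMod2 q :=
  Polynomial.map_mul _

theorem reduceMod2_eq_zero {p : (ZMod 4)[X]} (h : reduceMod2 p = 0) : ∃ r, p = 2 * r := by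
  have h1 : C (2 : ZMod 4) ∣ p := by
    rw [C_dvd_iff_dvd_coeff]
    intro i
    have h2 : ZMod.castHom (show 2 ∣ 4 by norm_num) (ZMod 2) (p.coeff i) = 0 := by
      rw [← coeff_map]; exact congrArg (fun r => coeff r i) h
    generalize p.coeff i = c at h2
    revert c
    decide
  exact h1

theorem eq_two_mul_of_two_mul_eq_zero {p : (ZMod 4)[X]} (h : 2 * p = 0) : ∃ r, p = 2 * r := by
  have h1 : C (2 : ZMod 4) ∣ p := by
    rw [C_dvd_iff_dvd_coeff]
    intro i
    have h2 : 2 * p.coeff i = 0 := by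
      rw [← coeff_C_mul]; exact congrArg (fun r => coeff r i) h
    generalize p.coeff i = c at h2
    revert c
    decide
  exact h1

theorem four_eq_zero : (4 : Φ.Ring) = 0 := by
  have h : (algebraMap (ZMod 4) Φ.Ring) 4 = 0 := by
    rw [show (4 : ZMod 4) = 0 from rfl, map_zero]
  rwa [map_ofNat] at h

theorem red_surjective : Function.Surjective Φ.red := by
  intro u
  obtain ⟨p, rfl⟩ := AdjoinRoot.mk_surjective u
  obtain ⟨p, rfl⟩ := reduceMod2_surjective p
  exact ⟨_, Φ.red_mk p⟩

/-- The kernel of reduction modulo `2` is `2ℛ`. -/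
theorem red_eq_zero {r : Φ.Ring} (h : Φ.red r = 0) : ∃ s, r = 2 * s := by
  obtain ⟨p, rfl⟩ := AdjoinRoot.mk_surjective r
  rw [red_mk, AdjoinRoot.mk_eq_zero] at h
  obtain ⟨g, hg⟩ := h
  obtain ⟨g, rfl⟩ := reduceMod2_surjective g
  have h0 : reduceMod2 (p - Φ.poly * g) = 0 := by
    rw [← reduceMod2_mul] at hg
    rw [reduceMod2, Polynomial.map_sub]
    exact sub_eq_zero.2 hg
  obtain ⟨s, hs⟩ := reduceMod2_eq_zero h0
  refine ⟨AdjoinRoot.mk _ s, ?_⟩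
  rw [sub_eq_iff_eq_add.1 hs]
  simp [map_ofNat (AdjoinRoot.mk Φ.poly) 2]

/-- The annihilator of `2` is `2ℛ`, so that `2r` depends only on `r` modulo `2` and determines it. -/
theorem two_mul_eq_zero_iff (r : Φ.Ring) : 2 * r = 0 ↔ Φ.red r = 0 := by
  constructor
  · intro h
    obtain ⟨p, rfl⟩ := AdjoinRoot.mk_surjective r
    have h' : AdjoinRoot.mk Φ.poly (2 * p) = 0 := by rwa [map_mul, map_ofNat]
    rw [AdjoinRoot.mk_eq_zero] at h'
    obtain ⟨g, hg⟩ := h'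
    have h2 : reduceMod2 2 = 0 := by
      rw [reduceMod2, Polynomial.map_ofNat]
      exact CharTwo.two_eq_zero
    have h3 : reduceMod2 g = 0 := by
      have := congrArg reduceMod2 hg
      rw [reduceMod2_mul, reduceMod2_mul, h2, zero_mul] at this
      exact (mul_eq_zero.1 this.symm).resolve_left Φ.reduce_monic.ne_zero
    obtain ⟨s, rfl⟩ := reduceMod2_eq_zero h3
    have h4 : 2 * (p - Φ.poly * s) = 0 := by rw [mul_sub, hg]; ring
    obtain ⟨t, ht⟩ := eq_two_mul_of_two_mul_eq_zero h4
    rw [red_mk, AdjoinRoot.mk_eq_zero]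
    refine ⟨reduceMod2 s, ?_⟩
    rw [sub_eq_iff_eq_add.1 ht, reduceMod2, Polynomial.map_add]
    change reduceMod2 (2 * t) + reduceMod2 (Φ.poly * s) = _
    rw [reduceMod2_mul, h2, zero_mul, zero_add, reduceMod2_mul]
  · intro h
    obtain ⟨s, rfl⟩ := Φ.red_eq_zero h
    rw [← mul_assoc, show (2 : Φ.Ring) * 2 = 4 by norm_num, four_eq_zero, zero_mul]

theorem two_mul_congr {r s : Φ.Ring} : 2 * r = 2 * s ↔ Φ.red r = Φ.red s := by
  rw [← sub_eq_zero, ← mul_sub, two_mul_eq_zero_iff, map_sub, sub_eq_zero]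

/-- The lifting principle behind the Teichmüller representatives: squaring turns congruences
modulo `2` into equalities modulo `4`. -/
theorem sq_congr {r s : Φ.Ring} (h : Φ.red r = Φ.red s) : r ^ 2 = s ^ 2 := by
  obtain ⟨t, ht⟩ := Φ.red_eq_zero (r := r - s) (by rw [map_sub, h, sub_self])
  rw [sub_eq_iff_eq_add.1 ht]
  linear_combination (t ^ 2 + t * s) * Φ.four_eq_zero

/-! ### Teichmüller representatives -/

/-- The Teichmüller representative of an element of the residue field: the `2 ^ e`-th power of
any lift of it to the Galois ring. -/
noncomputable def T (u : Φ.ResField) : Φ.Ring :=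
  Function.surjInv Φ.red_surjective u ^ 2 ^ e

theorem pow_eq_T (r : Φ.Ring) : r ^ 2 ^ e = Φ.T (Φ.red r) := by
  have h : 2 ^ e = 2 * 2 ^ (e - 1) := by
    rw [← pow_succ', Nat.sub_add_cancel (Nat.pos_of_ne_zero Φ.degree_ne_zero)]
  rw [T, h, pow_mul, pow_mul]
  congr 1
  apply Φ.sq_congr
  rw [Function.surjInv_eq Φ.red_surjective]

theorem red_T (u : Φ.ResField) : Φ.red (Φ.T u) = u := by
  rw [T, map_pow, Function.surjInv_eq Φ.red_surjective, ← Φ.card_resField, FiniteField.pow_card]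

theorem T_mul (u v : Φ.ResField) : Φ.T (u * v) = Φ.T u * Φ.T v := by
  conv_lhs => rw [← Φ.red_T u, ← Φ.red_T v, ← map_mul, ← pow_eq_T, mul_pow, pow_eq_T, pow_eq_T,
    red_T, red_T]

theorem T_zero : Φ.T 0 = 0 := by
  rw [← map_zero Φ.red, ← pow_eq_T, zero_pow (by positivity)]

theorem T_one : Φ.T 1 = 1 := by
  rw [← map_one Φ.red, ← pow_eq_T, one_pow]

theorem xi_pow : Φ.xi ^ (2 ^ e - 1) = 1 := by
  have h : AdjoinRoot.mk Φ.poly (X ^ (2 ^ e - 1) - 1) = 0 := AdjoinRoot.mk_eq_zero.2 Φ.dvd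
  rw [map_sub, map_pow, AdjoinRoot.mk_X, map_one, sub_eq_zero] at h
  exact h

theorem T_zeta_pow (j : ℕ) : Φ.T (Φ.zeta ^ j) = Φ.xi ^ j := by
  have h : Φ.xi ^ 2 ^ e = Φ.xi := by
    conv_lhs => rw [← Nat.sub_add_cancel (Nat.one_le_two_pow (n := e)), pow_succ, xi_pow, one_mul]
  rw [← red_xi, ← map_pow, ← pow_eq_T, ← pow_mul, mul_comm, pow_mul, h]

/-- Addition of Teichmüller representatives: the Witt vector addition formula modulo `4`. -/
theorem T_add (u v : Φ.ResField) :
    Φ.T (u + v) = Φ.T u + Φ.T v + 2 * Φ.T (Φ.sqrt (u * v)) := by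
  obtain ⟨a, rfl⟩ : ∃ a, u = a ^ 2 := ⟨_, (Φ.sqrt_sq u).symm⟩
  obtain ⟨b, rfl⟩ : ∃ b, v = b ^ 2 := ⟨_, (Φ.sqrt_sq v).symm⟩
  rw [← mul_pow, sqrt_sq_eq, ← CharTwo.add_sq, sq (a + b), sq a, sq b]
  simp only [T_mul]
  have h : Φ.T (a + b) ^ 2 = (Φ.T a + Φ.T b) ^ 2 := Φ.sq_congr (by simp [red_T])
  rw [← sq, h]
  ring

/-- The parametrization of the Galois ring by pairs of elements of the residue field, given by
Teichmüller coordinates. -/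
noncomputable def E (u s : Φ.ResField) : Φ.Ring := Φ.T u + 2 * Φ.T s

theorem red_E (u s : Φ.ResField) : Φ.red (Φ.E u s) = u := by
  rw [E, map_add, red_T, map_mul, map_ofNat, CharTwo.two_eq_zero (R := Φ.ResField), zero_mul,
    add_zero]

theorem E_inj {u s v t : Φ.ResField} : Φ.E u s = Φ.E v t ↔ u = v ∧ s = t := by
  constructor
  · intro h
    have h1 : u = v := by simpa only [red_E] using congrArg Φ.red h
    subst h1
    refine ⟨rfl, ?_⟩
    simpa only [red_T] using Φ.two_mul_congr.1 (add_left_cancel h)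
  · rintro ⟨rfl, rfl⟩; rfl

theorem E_surjective (x : Φ.Ring) : ∃ u s, x = Φ.E u s := by
  obtain ⟨r, hr⟩ := Φ.red_eq_zero (r := x - Φ.T (Φ.red x)) (by rw [map_sub, red_T, sub_self])
  refine ⟨Φ.red x, Φ.red r, ?_⟩
  rw [E, ← sub_eq_iff_eq_add', hr, two_mul_congr, red_T]

/-- The bijection underlying Teichmüller coordinates. -/
noncomputable def equivE : Φ.ResField × Φ.ResField ≃ Φ.Ring :=
  Equiv.ofBijective (fun p => Φ.E p.1 p.2)
    ⟨fun _ _ h => Prod.ext (Φ.E_inj.1 h).1 (Φ.E_inj.1 h).2,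
      fun x => by obtain ⟨u, s, rfl⟩ := Φ.E_surjective x; exact ⟨(u, s), rfl⟩⟩

/-- Subtraction in Teichmüller coordinates. The first coordinates add up, and the second ones are
additive up to a correction that depends on the first coordinates only. -/
theorem E_sub (z y u s : Φ.ResField) :
    Φ.E z y - Φ.E u s = Φ.E (z + u) (s + y + (u + Φ.sqrt (z * u))) := by
  have h : 2 * Φ.T (s + y + (u + Φ.sqrt (z * u)))
      = 2 * (Φ.T s + Φ.T y + (Φ.T u + Φ.T (Φ.sqrt (z * u)))) := by
    rw [two_mul_congr]; simp [red_T]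
  rw [E, E, E, T_add, h]
  linear_combination (-(Φ.T u) - Φ.T s - Φ.T (Φ.sqrt (z * u))) * Φ.four_eq_zero

/-! ### The classes of the scheme in Teichmüller coordinates -/

theorem E_zero_left (s : Φ.ResField) : Φ.E 0 s = 2 * Φ.T s := by
  rw [E, T_zero, zero_add]

theorem mem_teich (x : Φ.Ring) : x ∈ Φ.teich ↔ ∃ u ≠ 0, x = Φ.T u := by
  constructor
  · rintro ⟨j, -, rfl⟩
    exact ⟨Φ.zeta ^ j, pow_ne_zero _ Φ.zeta_ne_zero, (Φ.T_zeta_pow j).symm⟩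
  · rintro ⟨u, hu, rfl⟩
    obtain ⟨j, hj, rfl⟩ := Φ.exists_zeta_pow hu
    exact ⟨j, hj, Φ.T_zeta_pow j⟩

theorem mem_teich_diff_one (x : Φ.Ring) :
    x ∈ Φ.teich \ {1} ↔ ∃ u, u ≠ 0 ∧ u ≠ 1 ∧ x = Φ.T u := by
  rw [Set.mem_sdiff, mem_teich, Set.mem_singleton_iff, ← T_one]
  constructor
  · rintro ⟨⟨u, hu, rfl⟩, h⟩
    exact ⟨u, hu, fun h1 => h (by rw [h1]), rfl⟩
  · rintro ⟨u, hu, h1, rfl⟩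
    refine ⟨⟨u, hu, rfl⟩, fun h => h1 ?_⟩
    simpa only [red_T] using congrArg Φ.red h

theorem mem_P0 (x : Φ.Ring) :
    x ∈ Φ.P0 ↔ ∃ s, Algebra.trace (ZMod 2) Φ.ResField s = 0 ∧ x = 2 * Φ.T s := by
  constructor
  · rintro (⟨t, ⟨j, -, hj, rfl⟩, rfl⟩ | rfl)
    · exact ⟨Φ.zeta ^ j, hj, by rw [T_zeta_pow]⟩
    · exact ⟨0, map_zero _, by rw [T_zero, mul_zero]⟩
  · rintro ⟨s, hs, rfl⟩
    by_cases h : s = 0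
    · right; rw [h, T_zero, mul_zero]; rfl
    · left
      obtain ⟨j, hj, rfl⟩ := Φ.exists_zeta_pow h
      exact ⟨_, ⟨j, hj, hs, rfl⟩, by rw [T_zeta_pow]⟩

theorem mem_H (x : Φ.Ring) :
    x ∈ Φ.H ↔ ∃ s, Algebra.trace (ZMod 2) Φ.ResField s = 0 ∧ x = Φ.E 1 s := by
  constructor
  · rintro ⟨p, hp, rfl⟩
    obtain ⟨s, hs, rfl⟩ := (Φ.mem_P0 p).1 hp
    exact ⟨s, hs, by rw [E, T_one]⟩
  · rintro ⟨s, hs, rfl⟩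
    exact ⟨_, (Φ.mem_P0 _).2 ⟨s, hs, rfl⟩, by rw [E, T_one]⟩

theorem neg_E (u s : Φ.ResField) : -Φ.E u s = Φ.E u (s + u) := by
  have h := Φ.E_sub 0 0 u s
  rwa [E_zero_left, T_zero, mul_zero, zero_sub, zero_mul, zero_add, add_zero, sqrt,
    zero_pow (by positivity), add_zero] at h

theorem T_mul_E (u s : Φ.ResField) : Φ.T u * Φ.E 1 s = Φ.E u (u * s) := by
  rw [E, E, T_one, T_mul]; ring

/-- As `e` is odd, `Tr 1 = 1`, so that `-H` is the nontrivial coset of `H` in the principal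
units. -/
theorem mem_neg_H (he : Odd e) (x : Φ.Ring) :
    x ∈ -Φ.H ↔ ∃ s, Algebra.trace (ZMod 2) Φ.ResField s ≠ 0 ∧ x = Φ.E 1 s := by
  have key : ∀ s : Φ.ResField, Algebra.trace (ZMod 2) Φ.ResField (s + 1) = 0 ↔
      Algebra.trace (ZMod 2) Φ.ResField s ≠ 0 := by
    intro s
    rw [map_add, Φ.trace_one_of_odd he]
    generalize Algebra.trace (ZMod 2) Φ.ResField s = a
    revert a
    decide
  rw [Set.mem_neg, mem_H]
  constructor
  · rintro ⟨s, hs, h⟩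
    refine ⟨s + 1, ?_, by rw [← neg_E, ← h, neg_neg]⟩
    rw [← key, add_assoc, CharTwo.add_self_eq_zero, add_zero]
    exact hs
  · rintro ⟨s, hs, rfl⟩
    exact ⟨s + 1, (key s).2 hs, Φ.neg_E 1 s⟩

/-- The classes `S 1` and `S 2` are products of `𝒯 \ {1}` with a set `A` of principal units; as
`ξ ^ j (1 + 2s) = ξ ^ j + 2 ξ ^ j s`, membership depends on the ratio of the coordinates. -/
theorem E_mem_teich_mul {A : Set Φ.Ring} {p : Φ.ResField → Prop}
    (hA : ∀ x, x ∈ A ↔ ∃ s, p s ∧ x = Φ.E 1 s) (u s : Φ.ResField) :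
    Φ.E u s ∈ (Φ.teich \ {1}) * A ↔ u ≠ 0 ∧ u ≠ 1 ∧ p (s / u) := by
  rw [Set.mem_mul]
  constructor
  · rintro ⟨x, hx, y, hy, h⟩
    obtain ⟨v, hv0, hv1, rfl⟩ := (Φ.mem_teich_diff_one x).1 hx
    obtain ⟨t, ht, rfl⟩ := (hA y).1 hy
    rw [T_mul_E, E_inj] at h
    obtain ⟨rfl, rfl⟩ := h
    exact ⟨hv0, hv1, by rwa [mul_div_cancel_left₀ _ hv0]⟩
  · rintro ⟨h0, h1, hp⟩
    refine ⟨_, (Φ.mem_teich_diff_one _).2 ⟨u, h0, h1, rfl⟩, _, (hA _).2 ⟨_, hp, rfl⟩, ?_⟩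
    rw [T_mul_E, mul_div_cancel₀ _ h0]

theorem E_mem_maxIdeal (u s : Φ.ResField) : Φ.E u s ∈ Φ.maxIdeal ↔ u = 0 := by
  constructor
  · rintro ⟨r, hr⟩
    have h := congrArg Φ.red hr
    rwa [red_E, map_mul, map_ofNat, CharTwo.two_eq_zero (R := Φ.ResField), zero_mul] at h
  · rintro rfl
    exact ⟨_, Φ.E_zero_left s⟩

theorem E_mem_P0 (u s : Φ.ResField) :
    Φ.E u s ∈ Φ.P0 ↔ u = 0 ∧ Algebra.trace (ZMod 2) Φ.ResField s = 0 := by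
  rw [mem_P0]
  constructor
  · rintro ⟨t, ht, h⟩
    rw [← E_zero_left, E_inj] at h
    obtain ⟨rfl, rfl⟩ := h
    exact ⟨rfl, ht⟩
  · rintro ⟨rfl, hs⟩
    exact ⟨s, hs, Φ.E_zero_left s⟩

theorem E_zero_zero : Φ.E 0 0 = 0 := by rw [E_zero_left, T_zero, mul_zero]

theorem E_eq_zero (u s : Φ.ResField) : Φ.E u s = 0 ↔ u = 0 ∧ s = 0 := by
  rw [← E_zero_zero, E_inj]

/-- The index of the class of the scheme containing the element with Teichmüller coordinates
`(u, s)`. -/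
noncomputable def cls (u s : Φ.ResField) : Fin 7 :=
  if u = 0 then
    if s = 0 then 0 else if Algebra.trace (ZMod 2) Φ.ResField s = 0 then 5 else 6
  else if u = 1 then
    if Algebra.trace (ZMod 2) Φ.ResField s = 0 then 3 else 4
  else if Algebra.trace (ZMod 2) Φ.ResField (s / u) = 0 then 1 else 2

theorem E_mem_S (he : Odd e) (u s : Φ.ResField) (j : Fin 7) :
    Φ.E u s ∈ Φ.S j ↔ Φ.cls u s = j := by
  have h0 : Φ.E u s ∈ Φ.S 0 ↔ u = 0 ∧ s = 0 := Φ.E_eq_zero u s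
  have h1 : Φ.E u s ∈ Φ.S 1 ↔ _ := Φ.E_mem_teich_mul Φ.mem_H u s
  have h2 : Φ.E u s ∈ Φ.S 2 ↔ _ := Φ.E_mem_teich_mul (Φ.mem_neg_H he) u s
  have h3 : Φ.E u s ∈ Φ.S 3 ↔ u = 1 ∧ Algebra.trace (ZMod 2) Φ.ResField s = 0 := by
    refine (Φ.mem_H _).trans ⟨?_, ?_⟩
    · rintro ⟨t, ht, h⟩
      obtain ⟨rfl, rfl⟩ := Φ.E_inj.1 h
      exact ⟨rfl, ht⟩
    · rintro ⟨rfl, h⟩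
      exact ⟨s, h, rfl⟩
  have h4 : Φ.E u s ∈ Φ.S 4 ↔ u = 1 ∧ Algebra.trace (ZMod 2) Φ.ResField s ≠ 0 := by
    refine (Φ.mem_neg_H he _).trans ⟨?_, ?_⟩
    · rintro ⟨t, ht, h⟩
      obtain ⟨rfl, rfl⟩ := Φ.E_inj.1 h
      exact ⟨rfl, ht⟩
    · rintro ⟨rfl, h⟩
      exact ⟨s, h, rfl⟩
  have h5 : Φ.E u s ∈ Φ.S 5 ↔
      (u = 0 ∧ Algebra.trace (ZMod 2) Φ.ResField s = 0) ∧ ¬ (u = 0 ∧ s = 0) :=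
    and_congr (Φ.E_mem_P0 u s) (not_congr (Φ.E_eq_zero u s))
  have h6 : Φ.E u s ∈ Φ.S 6 ↔
      u = 0 ∧ ¬ (u = 0 ∧ Algebra.trace (ZMod 2) Φ.ResField s = 0) :=
    and_congr (Φ.E_mem_maxIdeal u s) (not_congr (Φ.E_mem_P0 u s))
  have ht : s = 0 → Algebra.trace (ZMod 2) Φ.ResField s = 0 := fun h => by rw [h, map_zero]
  have h01 : (0 : Φ.ResField) ≠ 1 := zero_ne_one
  unfold cls
  match j with
  | 0 => rw [h0]; split_ifs <;> simp_all
  | 1 => rw [h1]; split_ifs <;> simp_all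
  | 2 => rw [h2]; split_ifs <;> simp_all
  | 3 => rw [h3]; split_ifs <;> simp_all
  | 4 => rw [h4]; split_ifs <;> simp_all
  | 5 => rw [h5]; split_ifs <;> simp_all
  | 6 => rw [h6]; split_ifs <;> simp_all

/-- The entry of a linear combination of adjacency matrices at `(α, β)` is the weight of the class
of `α - β`. -/
theorem sum_smul_A_apply (he : Odd e) (w : Fin 7 → ℂ) {α β : Φ.Ring} {u s : Φ.ResField}
    (h : α - β = Φ.E u s) : (∑ j, w j • Φ.A j) α β = w (Φ.cls u s) := by
  simp only [Matrix.sum_apply, Matrix.smul_apply, A, R, Matrix.of_apply, h, Φ.E_mem_S he,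
    smul_eq_mul, mul_ite, mul_one, mul_zero]
  simp

end GaloisPolynomial

/-! ### Convolution of functions that are affine in a character on each fibre -/

section Convolution

variable {K : Type*} [Field K] [Fintype K] [DecidableEq K] {ψ : AddChar K ℂ}

theorem sum_addChar_mul (hψ : ψ ≠ 1) (c : K) :
    ∑ s, ψ (c * s) = if c = 0 then (Fintype.card K : ℂ) else 0 := by
  have h := AddChar.sum_mulShift c (AddChar.IsPrimitive.of_ne_one hψ)
  simp only [mul_comm _ c] at h
  rw [h]
  split_ifs <;> simp

theorem sum_addChar_div (hψ : ψ ≠ 1) {c : K} (hc : c ≠ 0) : ∑ s, ψ (s / c) = 0 := by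
  simp only [div_eq_inv_mul]
  rw [sum_addChar_mul hψ, if_neg (inv_ne_zero hc)]

/-- Distinct nontrivial multiplicative shifts of a character are orthogonal in characteristic
two, so that only the constant terms contribute to the convolution. -/
theorem sum_affine_mul_affine_of_ne [CharP K 2] (hψ : ψ ≠ 1) {u v : K} (hu : u ≠ 0) (hv : v ≠ 0)
    (huv : u ≠ v) (a b a' b' : ℂ) (t : K) :
    ∑ s, (a + b * ψ (s / u)) * (a' + b' * ψ ((s + t) / v)) = Fintype.card K * (a * a') := by
  have h : ∀ s, (a + b * ψ (s / u)) * (a' + b' * ψ ((s + t) / v)) =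
      a * a' + b * a' * ψ (s / u) + a * b' * ψ (t / v) * ψ (s / v)
        + b * b' * ψ (t / v) * ψ ((u⁻¹ + v⁻¹) * s) := by
    intro s
    rw [add_div, AddChar.map_add_eq_mul, add_mul u⁻¹, AddChar.map_add_eq_mul, ← div_eq_inv_mul,
      ← div_eq_inv_mul]
    ring
  have h0 : u⁻¹ + v⁻¹ ≠ 0 := fun h0 => huv (inv_injective (CharTwo.add_eq_zero.1 h0))
  simp only [h, Finset.sum_add_distrib, ← Finset.mul_sum, sum_addChar_div hψ hu,
    sum_addChar_div hψ hv, sum_addChar_mul hψ, if_neg h0]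
  simp only [Finset.sum_const, Finset.card_univ, nsmul_eq_mul]
  ring

theorem sum_affine_mul_affine_self [CharP K 2] (hψ : ψ ≠ 1) {u : K} (hu : u ≠ 0)
    (a b : ℂ) (t : K) :
    ∑ s, (a + b * ψ (s / u)) * (a + b * ψ ((s + t) / u)) =
      Fintype.card K * (a ^ 2 + b ^ 2 * ψ (t / u)) := by
  have h : ∀ s, (a + b * ψ (s / u)) * (a + b * ψ ((s + t) / u)) =
      (a ^ 2 + b ^ 2 * ψ (t / u)) + (a * b + a * b * ψ (t / u)) * ψ (s / u) := by
    intro s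
    have h2 : ψ (s / u) * ψ (s / u) = 1 := by
      rw [← AddChar.map_add_eq_mul, CharTwo.add_self_eq_zero, AddChar.map_zero_eq_one]
    rw [add_div, AddChar.map_add_eq_mul]
    linear_combination (b ^ 2 * ψ (t / u)) * h2
  simp only [h, Finset.sum_add_distrib, ← Finset.mul_sum, sum_addChar_div hψ hu]
  simp only [Finset.sum_const, Finset.card_univ, nsmul_eq_mul]
  ring

/-- The function on `K × K` which on the fibre over `u ≠ 0` is the affine function
`a u + b u * ψ (s / u)` of the character `s ↦ ψ (s / u)`, and on the fibre over `0` is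
`p + m * ψ s`, increased by `d` at `s = 0`. -/
noncomputable def fibreFun (ψ : AddChar K ℂ) (p m d : ℂ) (a b : K → ℂ) (u s : K) : ℂ :=
  if u = 0 then p + m * ψ s + d * (if s = 0 then 1 else 0) else a u + b u * ψ (s / u)

variable {p m d : ℂ} {a b : K → ℂ}

/-- The correlation of the fibre over `0`, which contains the frequencies `0`, `1` and a point mass,
with the fibre over `z`, which contains the frequencies `0` and `1 / z`. -/
theorem sum_fibreFun_zero_mul (hψ : ψ ≠ 1) [CharP K 2] {z : K} (hz : z ≠ 0) (y : K) :
    ∑ s, fibreFun ψ p m d a b 0 s * fibreFun ψ p m d a b z (s + y) =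
      a z * (Fintype.card K * p + d)
        + b z * ψ (y / z) * (Fintype.card K * m * (if z = 1 then 1 else 0) + d) := by
  have h : ∀ s, fibreFun ψ p m d a b 0 s * fibreFun ψ p m d a b z (s + y) =
      a z * p + a z * m * ψ (1 * s) + b z * ψ (y / z) * p * ψ (s / z)
        + b z * ψ (y / z) * m * ψ ((1 + z⁻¹) * s)
        + (if s = 0 then d * (a z + b z * ψ (y / z) * ψ (s / z)) else 0) := by
    intro s
    rw [add_mul 1, AddChar.map_add_eq_mul, ← div_eq_inv_mul, one_mul, fibreFun, if_pos rfl,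
      fibreFun, if_neg hz, add_div, AddChar.map_add_eq_mul]
    split_ifs <;> ring
  have h1 : 1 + z⁻¹ = 0 ↔ z = 1 := by rw [CharTwo.add_eq_zero, eq_comm, inv_eq_one]
  simp only [h, Finset.sum_add_distrib, ← Finset.mul_sum, sum_addChar_div hψ hz,
    sum_addChar_mul hψ, Finset.sum_ite_eq', h1]
  simp only [Finset.sum_const, Finset.card_univ, nsmul_eq_mul, one_ne_zero, if_false,
    Finset.mem_univ, if_true, zero_div, AddChar.map_zero_eq_one]
  split_ifs <;> ring

/-- The autocorrelation of a fibrewise affine function over `z ≠ 0`. -/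
theorem sum_fibreFun_mul_of_ne_zero (hψ : ψ ≠ 1) [CharP K 2] {z : K} (hz : z ≠ 0) (y : K)
    (g : K → K) (hg0 : g 0 = 0) (hgz : g z = 0) :
    ∑ u, ∑ s, fibreFun ψ p m d a b u s * fibreFun ψ p m d a b (z + u) (s + y + g u) =
      Fintype.card K * (∑ u, a u * a (z + u) - 2 * a 0 * a z)
        + 2 * (a z * (Fintype.card K * p + d)
          + b z * ψ (y / z) * (Fintype.card K * m * (if z = 1 then 1 else 0) + d)) := by
  set D := a z * (Fintype.card K * p + d)
          + b z * ψ (y / z) * (Fintype.card K * m * (if z = 1 then 1 else 0) + d) with hD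
  have h : ∀ u, ∑ s, fibreFun ψ p m d a b u s * fibreFun ψ p m d a b (z + u) (s + y + g u) =
      Fintype.card K * (a u * a (z + u))
        + (if u = 0 then D - Fintype.card K * (a 0 * a z) else 0)
        + (if u = z then D - Fintype.card K * (a 0 * a z) else 0) := by
    intro u
    by_cases hu : u = 0
    · subst hu
      rw [if_pos rfl, if_neg hz.symm, hg0]
      simp only [add_zero]
      rw [sum_fibreFun_zero_mul hψ hz]
      ring
    · by_cases huz : u = z
      · subst huz
        rw [if_neg hu, if_pos rfl, hgz, CharTwo.add_self_eq_zero]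
        simp only [add_zero]
        rw [← Equiv.sum_comp (Equiv.addRight y)]
        simp only [Equiv.coe_addRight, add_assoc, CharTwo.add_self_eq_zero, add_zero]
        simp only [mul_comm (fibreFun ψ p m d a b u _)]
        rw [sum_fibreFun_zero_mul hψ hz]
        ring
      · have hzu : z + u ≠ 0 := fun h => huz (CharTwo.add_eq_zero.1 h).symm
        have hne : u ≠ z + u := fun h => hz (by simpa using h)
        rw [if_neg hu, if_neg huz, add_zero, add_zero]
        simp only [fibreFun, if_neg hu, if_neg hzu, add_assoc]
        rw [sum_affine_mul_affine_of_ne hψ hu hzu hne]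
  simp only [h, Finset.sum_add_distrib, ← Finset.mul_sum, Finset.sum_ite_eq', Finset.mem_univ,
    if_true]
  ring

/-- The autocorrelation of a fibrewise affine function over `0`. -/
theorem sum_fibreFun_mul_zero (hψ : ψ ≠ 1) (hψ1 : ψ 1 = -1) [CharP K 2] (y : K) :
    ∑ u, ∑ s, fibreFun ψ p m 0 a b u s * fibreFun ψ p m 0 a b u (s + y + u) =
      Fintype.card K * (∑ u, (a u ^ 2 - b u ^ 2 * ψ (y / u)) - (a 0 ^ 2 - b 0 ^ 2)
        + p ^ 2 + m ^ 2 * ψ y) := by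
  have h : ∀ u, ∑ s, fibreFun ψ p m 0 a b u s * fibreFun ψ p m 0 a b u (s + y + u) =
      Fintype.card K * (a u ^ 2 - b u ^ 2 * ψ (y / u))
        + (if u = 0 then Fintype.card K * (p ^ 2 + m ^ 2 * ψ y - (a 0 ^ 2 - b 0 ^ 2)) else 0) := by
    intro u
    by_cases hu : u = 0
    · subst hu
      have h1 := sum_affine_mul_affine_self hψ (one_ne_zero (α := K)) p m y
      simp only [div_one] at h1
      simp only [fibreFun, if_true, zero_mul, add_zero, h1, div_zero, AddChar.map_zero_eq_one]
      ring
    · simp only [fibreFun, if_neg hu, add_assoc]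
      rw [sum_affine_mul_affine_self hψ hu, add_div, div_self hu, AddChar.map_add_eq_mul, hψ1]
      ring
  simp only [h, Finset.sum_add_distrib, ← Finset.mul_sum, Finset.sum_ite_eq', Finset.mem_univ,
    if_true]
  ring

theorem sum_addChar_div_left (hψ : ψ ≠ 1) {y : K} (hy : y ≠ 0) : ∑ u, ψ (y / u) = 0 := by
  have h := sum_addChar_mul hψ y
  rw [if_neg hy, ← Equiv.sum_comp (Equiv.inv K)] at h
  simpa [div_eq_mul_inv] using h

end Convolution

namespace GaloisPolynomial

variable {e : ℕ} (Φ : GaloisPolynomial e)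

/-! ### Autocorrelation of the weight function of a matrix in the Bose-Mesner algebra -/

/-- The autocorrelation `∑ₓ f(x) f(α - x)` at the point `α` with Teichmüller coordinates `(z, y)`,
where `f` takes the value `w j` on the class `S j`. -/
noncomputable def autocorr (w : Fin 7 → ℂ) (z y : Φ.ResField) : ℂ :=
  ∑ u, ∑ s, w (Φ.cls u s) * w (Φ.cls (z + u) (s + y + (u + Φ.sqrt (z * u))))

/-- The entries of `W * W` are the values of the autocorrelation of the weight function. -/
theorem mul_self_apply (he : Odd e) (w : Fin 7 → ℂ) {α β : Φ.Ring} {z y : Φ.ResField}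
    (h : α - β = Φ.E z y) :
    ((∑ j, w j • Φ.A j) * ∑ j, w j • Φ.A j) α β = Φ.autocorr w z y := by
  rw [Matrix.mul_apply, autocorr, ← Fintype.sum_prod_type',
    ← Equiv.sum_comp (Φ.equivE.trans (Equiv.subLeft α))]
  refine Finset.sum_congr rfl fun p _ => ?_
  have hp : (Φ.equivE.trans (Equiv.subLeft α)) p = α - Φ.E p.1 p.2 := rfl
  rw [hp, Φ.sum_smul_A_apply he w (u := p.1) (s := p.2) (by ring),
    Φ.sum_smul_A_apply he w (u := z + p.1) (s := p.2 + y + (p.1 + Φ.sqrt (z * p.1)))]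
  rw [← E_sub, ← h]
  ring

theorem psi_ne_one (he : Odd e) : Φ.psi ≠ 1 := by
  intro h
  have h1 := Φ.psi_one he
  rw [h, AddChar.one_apply] at h1
  norm_num at h1

/-- In Teichmüller coordinates the weight function is affine in a character on each fibre. -/
theorem weight_cls (w : Fin 7 → ℂ) (hw0 : w 0 = 1) (u s : Φ.ResField) :
    w (Φ.cls u s) = fibreFun Φ.psi ((w 5 + w 6) / 2) ((w 5 - w 6) / 2) (1 - w 5)
      (fun u => if u = 1 then (w 3 + w 4) / 2 else (w 1 + w 2) / 2)
      (fun u => if u = 1 then (w 3 - w 4) / 2 else (w 1 - w 2) / 2) u s := by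
  have ht : s = 0 → Algebra.trace (ZMod 2) Φ.ResField s = 0 := fun h => by rw [h, map_zero]
  simp only [fibreFun, cls, psi_apply]
  by_cases hu : u = 0
  · by_cases hs : s = 0
    · simp only [if_pos hu, if_pos hs, if_pos (ht hs), hw0]; ring
    · simp only [if_pos hu, if_neg hs]
      split_ifs <;> ring
  · by_cases h1 : u = 1
    · subst h1
      simp only [one_ne_zero, if_false, if_true, div_one]
      split_ifs <;> ring
    · simp only [if_neg hu, if_neg h1]
      split_ifs <;> ring

/-- The autocorrelation at units. The parameters `q`, `a`, `a3` abbreviate the order of the residue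
field and the means of the weights on `S 1 ∪ S 2` and `S 3 ∪ S 4`; `az` and `b` are the coefficients
of the weight function on the fibre over `z`. -/
theorem autocorr_of_ne_zero (he : Odd e) (w : Fin 7 → ℂ) (hw0 : w 0 = 1) {z : Φ.ResField}
    (hz : z ≠ 0) (y : Φ.ResField) {q a a3 az b : ℂ} (hq : q = 2 ^ e) (ha : a = (w 1 + w 2) / 2)
    (ha3 : a3 = (w 3 + w 4) / 2) (haz : az = if z = 1 then (w 3 + w 4) / 2 else (w 1 + w 2) / 2)
    (hb : b = if z = 1 then (w 3 - w 4) / 2 else (w 1 - w 2) / 2) :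
    Φ.autocorr w z y = q * (q * a ^ 2 + 2 * a * (a3 - a) - 2 * a * az)
      + 2 * (az * (q * ((w 5 + w 6) / 2) + (1 - w 5)) + b * Φ.psi (y / z)
        * (q * ((w 5 - w 6) / 2) * (if z = 1 then 1 else 0) + (1 - w 5))) := by
  have hcard : (Fintype.card Φ.ResField : ℂ) = q := by rw [hq, card_resField]; push_cast; rfl
  have hsum : ∑ u : Φ.ResField, (if u = 1 then a3 else a) * (if z + u = 1 then a3 else a)
      = q * a ^ 2 + 2 * a * (a3 - a) := by
    have h : ∀ u : Φ.ResField, (if u = 1 then a3 else a) * (if z + u = 1 then a3 else a) =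
        a ^ 2 + (if u = 1 then a * (a3 - a) else 0) + (if u = 1 + z then a * (a3 - a) else 0) := by
      intro u
      have h1 : z + u = 1 ↔ u = 1 + z := by
        rw [add_comm z u, CharTwo.add_eq_iff_eq_add]
      by_cases hu : u = 1
      · have h2 : u ≠ 1 + z := by rw [hu]; simpa using hz
        rw [if_pos hu, if_neg (h1.not.2 h2), if_pos hu, if_neg h2]; ring
      · by_cases h2 : u = 1 + z
        · rw [if_neg hu, if_pos (h1.2 h2), if_neg hu, if_pos h2]; ring
        · rw [if_neg hu, if_neg (h1.not.2 h2), if_neg hu, if_neg h2]; ring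
    simp only [h, Finset.sum_add_distrib, Finset.sum_ite_eq', Finset.mem_univ, if_true,
      Finset.sum_const, Finset.card_univ, nsmul_eq_mul, hcard]
    ring
  simp only [autocorr, Φ.weight_cls w hw0]
  rw [sum_fibreFun_mul_of_ne_zero (Φ.psi_ne_one he) hz y (fun u => u + Φ.sqrt (z * u))
    (by simp [sqrt]) (by simp only [← sq, sqrt_sq_eq]; exact CharTwo.add_self_eq_zero z)]
  simp only [← ha, ← ha3] at haz ⊢
  rw [hsum, hcard, ← haz, ← hb, if_neg (zero_ne_one)]

/-- The autocorrelation at nonzero elements of the maximal ideal, when `w 5 = 1`. -/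
theorem autocorr_zero (he : Odd e) (w : Fin 7 → ℂ) (hw0 : w 0 = 1) (hw5 : w 5 = 1)
    {y : Φ.ResField} (hy : y ≠ 0) {q a a3 b b3 : ℂ} (hq : q = 2 ^ e) (ha : a = (w 1 + w 2) / 2)
    (ha3 : a3 = (w 3 + w 4) / 2) (hb : b = (w 1 - w 2) / 2) (hb3 : b3 = (w 3 - w 4) / 2) :
    Φ.autocorr w 0 y = q * ((q - 2) * a ^ 2 + a3 ^ 2 + b ^ 2 * (1 + Φ.psi y) - b3 ^ 2 * Φ.psi y
      + ((w 5 + w 6) / 2) ^ 2 + ((w 5 - w 6) / 2) ^ 2 * Φ.psi y) := by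
  have hcard : (Fintype.card Φ.ResField : ℂ) = q := by rw [hq, card_resField]; push_cast; rfl
  have hsum : ∑ u : Φ.ResField, ((if u = 1 then a3 else a) ^ 2
      - (if u = 1 then b3 else b) ^ 2 * Φ.psi (y / u)) =
      (q - 1) * a ^ 2 + a3 ^ 2 + b ^ 2 * Φ.psi y - b3 ^ 2 * Φ.psi y := by
    have h : ∀ u : Φ.ResField, ((if u = 1 then a3 else a) ^ 2
        - (if u = 1 then b3 else b) ^ 2 * Φ.psi (y / u)) =
        a ^ 2 - b ^ 2 * Φ.psi (y / u)
          + (if u = 1 then a3 ^ 2 - a ^ 2 - (b3 ^ 2 - b ^ 2) * Φ.psi (y / u) else 0) := by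
      intro u
      split_ifs <;> ring
    simp only [h, Finset.sum_add_distrib, Finset.sum_sub_distrib, ← Finset.mul_sum,
      Finset.sum_ite_eq', Finset.mem_univ, if_true, Finset.sum_const, Finset.card_univ,
      nsmul_eq_mul, hcard, sum_addChar_div_left (Φ.psi_ne_one he) hy, div_one]
    ring
  simp only [autocorr, Φ.weight_cls w hw0, ← ha, ← ha3, ← hb, ← hb3]
  have hs : Φ.sqrt 0 = 0 := by simp [sqrt]
  simp only [zero_mul, hs, add_zero, zero_add]
  rw [show 1 - w 5 = 0 by rw [hw5, sub_self],
    sum_fibreFun_mul_zero (Φ.psi_ne_one he) (Φ.psi_one he), hsum, hcard, if_neg zero_ne_one,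
    if_neg zero_ne_one]
  ring

end GaloisPolynomial

namespace GaloisPolynomial

variable {e : ℕ} (Φ : GaloisPolynomial e)

/-! ### Hermitian matrices in the Bose-Mesner algebra -/

theorem zeta_ne_one (he3 : 3 ≤ e) : Φ.zeta ≠ 1 := by
  intro h
  have h1 := Φ.orderOf_zeta
  have h2 : 2 ^ 3 ≤ 2 ^ e := Nat.pow_le_pow_right (by norm_num) he3
  rw [h, orderOf_one] at h1
  omega

theorem exists_ne_zero_trace_eq_zero (he : Odd e) (he3 : 3 ≤ e) :
    ∃ s : Φ.ResField, s ≠ 0 ∧ Algebra.trace (ZMod 2) Φ.ResField s = 0 := by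
  -- One of `ζ` and `ζ + 1` has trace `0`, because `Tr 1 = 1`.
  by_cases h : Algebra.trace (ZMod 2) Φ.ResField Φ.zeta = 0
  · exact ⟨_, Φ.zeta_ne_zero, h⟩
  · refine ⟨Φ.zeta + 1, fun h0 => Φ.zeta_ne_one he3 (CharTwo.add_eq_zero.1 h0), ?_⟩
    rw [map_add, Φ.trace_one_of_odd he]
    generalize Algebra.trace (ZMod 2) Φ.ResField Φ.zeta = t at h
    revert t
    decide

theorem star_weight_of_isHermitian (he : Odd e) (w : Fin 7 → ℂ)
    (h : (∑ j, w j • Φ.A j).IsHermitian) (u s : Φ.ResField) :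
    star (w (Φ.cls u s)) = w (Φ.cls u (s + u)) := by
  have h1 := h.apply 0 (Φ.E u s)
  rwa [Φ.sum_smul_A_apply he w (sub_zero _),
    Φ.sum_smul_A_apply he w ((zero_sub _).trans (Φ.neg_E u s))] at h1

/-- A Hermitian matrix in the Bose-Mesner algebra has conjugate weights on the pairs of mutually
transposed relations, and real weights on the symmetric ones. -/
theorem weights_of_isHermitian (he : Odd e) (he3 : 3 ≤ e) (w : Fin 7 → ℂ)
    (h : (∑ j, w j • Φ.A j).IsHermitian) :
    w 2 = star (w 1) ∧ w 4 = star (w 3) ∧ star (w 5) = w 5 ∧ star (w 6) = w 6 := by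
  have h0 := Φ.zeta_ne_zero
  have h1 := Φ.zeta_ne_one he3
  have key := Φ.star_weight_of_isHermitian he w h
  obtain ⟨s, hs0, hs⟩ := Φ.exists_ne_zero_trace_eq_zero he he3
  have k1 := key Φ.zeta 0
  have k3 := key 1 0
  have k5 := key 0 s
  have k6 := key 0 1
  have ht := Φ.trace_one_of_odd he
  simp only [cls, h0, h1, hs0, hs, ht, zero_add, add_zero, zero_div, div_self h0, map_zero,
    one_ne_zero, if_true, if_false] at k1 k3 k5 k6
  exact ⟨k1.symm, k3.symm, k5, k6⟩

theorem isComplexHadamard_iff_autocorr (he : Odd e) (w : Fin 7 → ℂ) (hw : ∀ j, ‖w j‖ = 1)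
    (h : (∑ j, w j • Φ.A j).IsHermitian) :
    IsComplexHadamard (∑ j, w j • Φ.A j) ↔
      ∀ z y, ¬ (z = 0 ∧ y = 0) → Φ.autocorr w z y = 0 := by
  have hnorm : ∀ x y, ‖(∑ j, w j • Φ.A j) x y‖ = 1 := by
    intro x y
    obtain ⟨u, s, hus⟩ := Φ.E_surjective (x - y)
    rw [Φ.sum_smul_A_apply he w hus, hw]
  unfold IsComplexHadamard
  rw [and_iff_right hnorm, ← Matrix.ext_iff]
  constructor
  · intro hW z y hzy
    have h1 := hW (Φ.E z y) 0
    rw [h.eq, Φ.mul_self_apply he w (sub_zero _), Matrix.smul_apply, Matrix.one_apply_ne, smul_zero]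
      at h1
    · exact h1
    · rwa [Ne, E_eq_zero]
  · intro hC x y
    by_cases hxy : x = y
    · subst hxy
      rw [Matrix.mul_apply, Matrix.smul_apply, Matrix.one_apply_eq]
      have h1 : ∀ γ, (∑ j, w j • Φ.A j) x γ * (∑ j, w j • Φ.A j)ᴴ γ x = 1 := by
        intro γ
        rw [Matrix.conjTranspose_apply, Complex.star_def, Complex.mul_conj, Complex.normSq_eq_norm_sq,
          hnorm]
        norm_num
      rw [Finset.sum_congr rfl fun γ _ => h1 γ]
      simp
    · obtain ⟨z, t, hzt⟩ := Φ.E_surjective (x - y)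
      rw [h.eq, Φ.mul_self_apply he w hzt, Matrix.smul_apply, Matrix.one_apply_ne hxy, smul_zero]
      refine hC z t fun h0 => hxy ?_
      rw [← sub_eq_zero, hzt, h0.1, h0.2, E_zero_zero]

end GaloisPolynomial

/-! ### Solving the autocorrelation equations -/

/-- The weights on the units enter through the real and imaginary parts `a`, `b` of `w 1` and `a3`,
`b3` of `w 3`; the equations `h1`, ..., `h4` force `a = 0` and leave two families of solutions. -/
theorem weights_eq_of_autocorr_eqs {q a b a3 b3 w5 w6 : ℝ} (hq : 8 ≤ q) (hab : a ^ 2 + b ^ 2 = 1)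
    (hab3 : a3 ^ 2 + b3 ^ 2 = 1) (h5 : w5 = 1 ∨ w5 = -1) (h6 : w6 = 1 ∨ w6 = -1)
    (h1 : b * (1 - w5) = 0)
    (h2 : q * ((q - 2) * a ^ 2) + 2 * (a3 * (q * ((w5 + w6) / 2) + (1 - w5))) = 0)
    (h3 : b3 * (q * ((w5 - w6) / 2) + (1 - w5)) = 0)
    (h4 : w5 = 1 → (q - 2) * a ^ 2 + a3 ^ 2 - b3 ^ 2 + ((w5 + w6) / 2) ^ 2
      - ((w5 - w6) / 2) ^ 2 = 0) :
    a = 0 ∧ w5 = 1 ∧ (w6 = 1 ∧ a3 = 0 ∨ w6 = -1 ∧ b3 = 0) := by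
  rcases h5 with rfl | rfl
  · have h4 := h4 rfl
    rcases h6 with rfl | rfl
    · have ha : a ^ 2 = 0 := by nlinarith [sq_nonneg a, sq_nonneg a3]
      have ha3 : a3 ^ 2 = 0 := by nlinarith [sq_nonneg a, sq_nonneg a3]
      exact ⟨by simpa using ha, rfl, Or.inl ⟨rfl, by simpa using ha3⟩⟩
    · have hb3 : b3 = 0 := by
        have : b3 * q = 0 := by linear_combination h3
        exact (mul_eq_zero.1 this).resolve_right (by linarith)
      have ha : a ^ 2 = 0 := by
        have : (q * (q - 2)) * a ^ 2 = 0 := by linear_combination h2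
        exact (mul_eq_zero.1 this).resolve_left (by nlinarith)
      exact ⟨by simpa using ha, rfl, Or.inr ⟨rfl, hb3⟩⟩
  · -- Now `a ^ 2 = 1`, and the term `q * (q - 2)` is too large to be cancelled, as `q ≥ 8`.
    exfalso
    have hb : b = 0 := by linarith
    have ha : a ^ 2 = 1 := by rw [← hab, hb]; ring
    have ha3 : |a3| ≤ 1 := by
      rw [← sq_le_one_iff_abs_le_one]; nlinarith [sq_nonneg b3]
    obtain ⟨h7, h8⟩ := abs_le.1 ha3
    rw [ha] at h2
    rcases h6 with rfl | rfl <;> nlinarith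

theorem eq_one_or_neg_one_of_norm_of_star {x : ℂ} (hx : ‖x‖ = 1) (hs : star x = x) :
    x.re = 1 ∨ x.re = -1 := by
  have h1 : x = (x.re : ℂ) := (Complex.conj_eq_iff_re.1 hs).symm
  rw [h1, Complex.norm_real, Real.norm_eq_abs] at hx
  exact (abs_eq zero_le_one).1 hx

namespace GaloisPolynomial

variable {e : ℕ} (Φ : GaloisPolynomial e)

/-- The weights of a Hermitian complex Hadamard matrix in the Bose-Mesner algebra. The equations
that determine them are the vanishing of the autocorrelation at the points with Teichmüller
coordinates `(ζ, 0)`, `(ζ, ζ)`, `(1, 0)`, `(1, 1)` and `(0, 1)`. -/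
theorem weights_of_isComplexHadamard (he : Odd e) (he3 : 3 ≤ e) (w : Fin 7 → ℂ) (hw0 : w 0 = 1)
    (hw : ∀ j, ‖w j‖ = 1) (h : (∑ j, w j • Φ.A j).IsHermitian)
    (hW : IsComplexHadamard (∑ j, w j • Φ.A j)) :
    ∃ ε₁ ∈ ({1, -1} : Set ℂ), ∃ ε₂ ∈ ({1, -1} : Set ℂ),
      w = ![1, ε₁ * Complex.I, -(ε₁ * Complex.I), ε₂ * Complex.I, -(ε₂ * Complex.I), 1, 1] ∨
      w = ![1, ε₁ * Complex.I, -(ε₁ * Complex.I), ε₂, ε₂, 1, -1] := by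
  rw [Φ.isComplexHadamard_iff_autocorr he w hw h] at hW
  obtain ⟨k2, k4, k5, k6⟩ := Φ.weights_of_isHermitian he he3 w h
  have r5 := eq_one_or_neg_one_of_norm_of_star (hw 5) k5
  have r6 := eq_one_or_neg_one_of_norm_of_star (hw 6) k6
  have c5 : w 5 = ((w 5).re : ℂ) := (Complex.conj_eq_iff_re.1 k5).symm
  have c6 : w 6 = ((w 6).re : ℂ) := (Complex.conj_eq_iff_re.1 k6).symm
  have n1 : (w 1).re ^ 2 + (w 1).im ^ 2 = 1 := by
    rw [sq, sq, ← Complex.normSq_apply, Complex.normSq_eq_norm_sq, hw]; norm_num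
  have n3 : (w 3).re ^ 2 + (w 3).im ^ 2 = 1 := by
    rw [sq, sq, ← Complex.normSq_apply, Complex.normSq_eq_norm_sq, hw]; norm_num
  have c1 : w 1 = (w 1).re + (w 1).im * Complex.I := (Complex.re_add_im _).symm
  have c3 : w 3 = (w 3).re + (w 3).im * Complex.I := (Complex.re_add_im _).symm
  have c2 : w 2 = (w 1).re - (w 1).im * Complex.I := by
    rw [k2]; apply Complex.ext <;> simp
  have c4 : w 4 = (w 3).re - (w 3).im * Complex.I := by
    rw [k4]; apply Complex.ext <;> simp
  generalize (w 1).re = a, (w 1).im = b, (w 3).re = a₃, (w 3).im = b₃, (w 5).re = w₅,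
    (w 6).re = w₆ at *
  have ha : (a : ℂ) = (w 1 + w 2) / 2 := by rw [c1, c2]; ring
  have hb : (b : ℂ) * Complex.I = (w 1 - w 2) / 2 := by rw [c1, c2]; ring
  have ha₃ : (a₃ : ℂ) = (w 3 + w 4) / 2 := by rw [c3, c4]; ring
  have hb₃ : (b₃ : ℂ) * Complex.I = (w 3 - w 4) / 2 := by rw [c3, c4]; ring
  have hz0 := Φ.zeta_ne_zero
  have hz1 := Φ.zeta_ne_one he3
  have hψ := Φ.psi_one he
  have E1 := hW Φ.zeta 0 (fun h => hz0 h.1)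
  have E2 := hW Φ.zeta Φ.zeta (fun h => hz0 h.1)
  have E3 := hW 1 0 (fun h => one_ne_zero h.1)
  have E4 := hW 1 1 (fun h => one_ne_zero h.1)
  have E5 := hW 0 1 (fun h => one_ne_zero h.2)
  rw [Φ.autocorr_of_ne_zero he w hw0 hz0 _ (az := a) (b := b * Complex.I) rfl ha ha₃
    (by rw [if_neg hz1, ha]) (by rw [if_neg hz1, hb]), if_neg hz1, c5] at E1 E2
  rw [Φ.autocorr_of_ne_zero he w hw0 one_ne_zero _ (az := a₃) (b := b₃ * Complex.I) rfl ha ha₃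
    (by rw [if_pos rfl, ha₃]) (by rw [if_pos rfl, hb₃]), if_pos rfl, c5, c6] at E3 E4
  rw [zero_div, AddChar.map_zero_eq_one] at E1 E3
  rw [div_self hz0, hψ] at E2
  rw [div_self one_ne_zero, hψ] at E4
  have h1 : b * (1 - w₅) = 0 := by
    have : Complex.I * ((b * (1 - w₅) : ℝ) : ℂ) = 0 := by
      push_cast; linear_combination (E1 - E2) / 4
    exact_mod_cast (mul_eq_zero.1 this).resolve_left Complex.I_ne_zero
  have h2 : (2 : ℝ) ^ e * ((2 ^ e - 2) * a ^ 2)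
      + 2 * (a₃ * (2 ^ e * ((w₅ + w₆) / 2) + (1 - w₅))) = 0 := by
    have : (((2 : ℝ) ^ e * ((2 ^ e - 2) * a ^ 2)
      + 2 * (a₃ * (2 ^ e * ((w₅ + w₆) / 2) + (1 - w₅))) : ℝ) : ℂ) = 0 := by
      push_cast; linear_combination (E3 + E4) / 2
    exact_mod_cast this
  have h3 : b₃ * (2 ^ e * ((w₅ - w₆) / 2) + (1 - w₅)) = 0 := by
    have : Complex.I * ((b₃ * (2 ^ e * ((w₅ - w₆) / 2) + (1 - w₅)) : ℝ) : ℂ) = 0 := by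
      push_cast; linear_combination (E3 - E4) / 4
    exact_mod_cast (mul_eq_zero.1 this).resolve_left Complex.I_ne_zero
  have h4 : w₅ = 1 → ((2 : ℝ) ^ e - 2) * a ^ 2 + a₃ ^ 2 - b₃ ^ 2
      + ((w₅ + w₆) / 2) ^ 2 - ((w₅ - w₆) / 2) ^ 2 = 0 := by
    intro h5
    rw [Φ.autocorr_zero he w hw0 (by rw [c5, h5, Complex.ofReal_one]) one_ne_zero rfl ha ha₃ hb
      hb₃, hψ, c5, c6] at E5
    have E5 := (mul_eq_zero.1 E5).resolve_left (pow_ne_zero _ two_ne_zero)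
    have : ((((2 : ℝ) ^ e - 2) * a ^ 2 + a₃ ^ 2 - b₃ ^ 2
      + ((w₅ + w₆) / 2) ^ 2 - ((w₅ - w₆) / 2) ^ 2 : ℝ) : ℂ) = 0 := by
      push_cast; linear_combination E5 - b₃ ^ 2 * Complex.I_sq
    exact_mod_cast this
  have hq : (8 : ℝ) ≤ 2 ^ e := by
    calc (8 : ℝ) = 2 ^ 3 := by norm_num
      _ ≤ 2 ^ e := pow_le_pow_right₀ (by norm_num) he3
  have mem : ∀ {x : ℝ}, x = 1 ∨ x = -1 → (x : ℂ) ∈ ({1, -1} : Set ℂ) := by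
    rintro x (rfl | rfl) <;> simp
  obtain ⟨rfl, rfl, ⟨rfl, rfl⟩ | ⟨rfl, rfl⟩⟩ :=
    weights_eq_of_autocorr_eqs hq n1 n3 r5 r6 h1 h2 h3 h4
  · refine ⟨b, mem (sq_eq_one_iff.1 (by linarith)), b₃, mem (sq_eq_one_iff.1 (by linarith)),
      Or.inl ?_⟩
    funext j
    fin_cases j <;> simp [hw0, c1, c2, c3, c4, c5, c6]
  · refine ⟨b, mem (sq_eq_one_iff.1 (by linarith)), a₃, mem (sq_eq_one_iff.1 (by linarith)),
      Or.inr ?_⟩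
    funext j
    fin_cases j <;> simp [hw0, c1, c2, c3, c4, c5, c6]

/-- The two families of weights do give complex Hadamard matrices. In both cases `w 1 + w 2 = 0` and
`w 5 = 1`, and the remaining terms of the autocorrelation cancel. -/
theorem isComplexHadamard_of_weights (he : Odd e) (w : Fin 7 → ℂ) (hw0 : w 0 = 1)
    (hw : ∀ j, ‖w j‖ = 1) (h : (∑ j, w j • Φ.A j).IsHermitian) (h2 : w 2 = -w 1)
    (h1 : w 1 ^ 2 = -1) (h5 : w 5 = 1)
    (h6 : w 6 = 1 ∧ w 4 = -w 3 ∧ w 3 ^ 2 = -1 ∨ w 6 = -1 ∧ w 4 = w 3 ∧ w 3 ^ 2 = 1) :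
    IsComplexHadamard (∑ j, w j • Φ.A j) := by
  rw [Φ.isComplexHadamard_iff_autocorr he w hw h]
  intro z y hzy
  have ha : (0 : ℂ) = (w 1 + w 2) / 2 := by rw [h2]; ring
  have hb : w 1 = (w 1 - w 2) / 2 := by rw [h2]; ring
  by_cases hz : z = 0
  · subst hz
    have hy : y ≠ 0 := fun hy => hzy ⟨rfl, hy⟩
    rw [Φ.autocorr_zero he w hw0 h5 hy rfl ha rfl hb rfl, h1, h5]
    rcases h6 with ⟨h6, h4, h3⟩ | ⟨h6, h4, h3⟩
    · rw [h6, h4]; linear_combination (-(2 ^ e * Φ.psi y)) * h3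
    · rw [h6, h4]; linear_combination 2 ^ e * h3
  · rw [Φ.autocorr_of_ne_zero he w hw0 hz y rfl ha rfl rfl rfl, ← ha, ← hb, h5]
    rcases h6 with ⟨h6, h4, h3⟩ | ⟨h6, h4, h3⟩
    · rw [h6, h4]; split_ifs <;> ring
    · rw [h6, h4]; split_ifs <;> ring

theorem sum_smul_A_eq_first (ε₁ ε₂ : ℂ) :
    ∑ j, (![1, ε₁ * Complex.I, -(ε₁ * Complex.I), ε₂ * Complex.I, -(ε₂ * Complex.I), 1, 1] :
      Fin 7 → ℂ) j • Φ.A j = Φ.A 0 + (ε₁ * Complex.I) • (Φ.A 1 - Φ.A 2)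
        + (ε₂ * Complex.I) • (Φ.A 3 - Φ.A 4) + Φ.A 5 + Φ.A 6 := by
  simp only [Fin.sum_univ_seven]
  change (1 : ℂ) • Φ.A 0 + (ε₁ * Complex.I) • Φ.A 1 + (-(ε₁ * Complex.I)) • Φ.A 2
    + (ε₂ * Complex.I) • Φ.A 3 + (-(ε₂ * Complex.I)) • Φ.A 4 + (1 : ℂ) • Φ.A 5
    + (1 : ℂ) • Φ.A 6 = _
  module

theorem sum_smul_A_eq_second (ε₁ ε₂ : ℂ) :
    ∑ j, (![1, ε₁ * Complex.I, -(ε₁ * Complex.I), ε₂, ε₂, 1, -1] : Fin 7 → ℂ) j • Φ.A j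
      = Φ.A 0 + (ε₁ * Complex.I) • (Φ.A 1 - Φ.A 2) + ε₂ • (Φ.A 3 + Φ.A 4)
        + Φ.A 5 - Φ.A 6 := by
  simp only [Fin.sum_univ_seven]
  change (1 : ℂ) • Φ.A 0 + (ε₁ * Complex.I) • Φ.A 1 + (-(ε₁ * Complex.I)) • Φ.A 2
    + ε₂ • Φ.A 3 + ε₂ • Φ.A 4 + (1 : ℂ) • Φ.A 5 + (-1 : ℂ) • Φ.A 6 = _
  module

theorem weights_pow_four {ε₁ ε₂ : ℂ} (h₁ : ε₁ ∈ ({1, -1} : Set ℂ))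
    (h₂ : ε₂ ∈ ({1, -1} : Set ℂ)) {w : Fin 7 → ℂ}
    (h : w = ![1, ε₁ * Complex.I, -(ε₁ * Complex.I), ε₂ * Complex.I, -(ε₂ * Complex.I), 1, 1] ∨
      w = ![1, ε₁ * Complex.I, -(ε₁ * Complex.I), ε₂, ε₂, 1, -1]) (j : Fin 7) : w j ^ 4 = 1 := by
  have h4 : Even 4 := by decide
  rcases h₁ with rfl | rfl <;> rcases h₂ with rfl | rfl <;> rcases h with rfl | rfl <;>
    fin_cases j <;> simp [h4.neg_pow]

end GaloisPolynomial

theorem mainTheorem3 (e : ℕ) (he : Odd e) (he3 : 3 ≤ e) (Φ : GaloisPolynomial e)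
    (w : Fin 7 → ℂ) (hw0 : w 0 = 1) (hw : ∀ j, ‖w j‖ = 1)
    (W : Matrix Φ.Ring Φ.Ring ℂ) (hW : W = ∑ j, w j • Φ.A j) (hherm : W.IsHermitian) :
    (IsComplexHadamard W ↔
      ∃ ε₁ ∈ ({1, -1} : Set ℂ), ∃ ε₂ ∈ ({1, -1} : Set ℂ),
        W = Φ.A 0 + (ε₁ * Complex.I) • (Φ.A 1 - Φ.A 2) + (ε₂ * Complex.I) • (Φ.A 3 - Φ.A 4)
            + Φ.A 5 + Φ.A 6 ∨
        W = Φ.A 0 + (ε₁ * Complex.I) • (Φ.A 1 - Φ.A 2) + ε₂ • (Φ.A 3 + Φ.A 4)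
            + Φ.A 5 - Φ.A 6) ∧
    (IsComplexHadamard W → IsButsonType 4 W) := by
  refine ⟨⟨fun h => ?_, ?_⟩, fun h => ⟨h, fun x y => ?_⟩⟩
  · rw [hW] at hherm h
    obtain ⟨ε₁, h₁, ε₂, h₂, hε⟩ :=
      Φ.weights_of_isComplexHadamard he he3 w hw0 hw hherm h
    refine ⟨ε₁, h₁, ε₂, h₂, hε.imp (fun hε => ?_) (fun hε => ?_)⟩
    · rw [hW, hε, Φ.sum_smul_A_eq_first]
    · rw [hW, hε, Φ.sum_smul_A_eq_second]
  · rintro ⟨ε₁, h₁, ε₂, h₂, hε⟩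
    have s₁ : ε₁ ^ 2 = 1 := sq_eq_one_iff.2 h₁
    have s₂ : ε₂ ^ 2 = 1 := sq_eq_one_iff.2 h₂
    have q₁ : (ε₁ * Complex.I) ^ 2 = -1 := by rw [mul_pow, s₁, Complex.I_sq, one_mul]
    have q₂ : (ε₂ * Complex.I) ^ 2 = -1 := by rw [mul_pow, s₂, Complex.I_sq, one_mul]
    rcases hε with hε | hε
    · rw [← Φ.sum_smul_A_eq_first] at hε
      rw [hε] at hherm ⊢
      exact Φ.isComplexHadamard_of_weights he _ rfl
        (fun j => Complex.norm_eq_one_of_pow_eq_one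
          (GaloisPolynomial.weights_pow_four h₁ h₂ (Or.inl rfl) j) four_ne_zero)
        hherm rfl q₁ rfl (Or.inl ⟨rfl, rfl, q₂⟩)
    · rw [← Φ.sum_smul_A_eq_second] at hε
      rw [hε] at hherm ⊢
      exact Φ.isComplexHadamard_of_weights he _ rfl
        (fun j => Complex.norm_eq_one_of_pow_eq_one
          (GaloisPolynomial.weights_pow_four h₁ h₂ (Or.inr rfl) j) four_ne_zero)
        hherm rfl q₁ rfl (Or.inr ⟨rfl, rfl, s₂⟩)
  · rw [hW] at hherm h
    obtain ⟨ε₁, h₁, ε₂, h₂, hε⟩ :=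
      Φ.weights_of_isComplexHadamard he he3 w hw0 hw hherm h
    obtain ⟨u, s, hus⟩ := Φ.E_surjective (x - y)
    rw [hW, Φ.sum_smul_A_apply he w hus]
    exact GaloisPolynomial.weights_pow_four h₁ h₂ hε _
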